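/- A graph $X$ is given by finite sets $\mathcal S_X$ (vertices) and $\mathcal A_X$ (edges), maps $\mathrm o,\mathrm e:\mathcal A_X\to\mathcal S_X$ and a fixed-point-free involution $a\mapsto -a$ of $\mathcal A_X$ with $\mathrm e(a)=\mathrm o(-a)$; an orientation is a set $\mathcal A_X^+$ containing exactly one of $a,-a$ for each $a$. A decomposed graph of groups $(\mathcal G,X,T)$ consists of a connected oriented graph $X$, vertex groups $G_s$ ($s\in\mathcal S_X$), edge groups $G_a$ ($a\in\mathcal A^+_X$), monomorphisms $\phi_a:G_a\to G_{\mathrm o(a)}$, $\phi_{-a}:G_a\to G_{\mathrm e(a)}$, and a maximal tree $T$ of $X$. Its fundamental group $\Gamma$ is the quotient of the free product of all $G_s$ and of the free group on $\{t_a: a\in\mathcal A_X\}$ by the relations $\phi_a(h)=t_a\phi_{-a}(h)t_a^{-1}$ ($a\in\mathcal A_X^+$, $h\in G_a$), $t_{-a}=t_a^{-1}$ ($a\in\mathcal A_X$), and $t_a=1$ ($a\in\mathcal A_T$). Each $G_s$ is identified with its image in $\Gamma$. For $a\in\mathcal A_X^+$ let $G_a^-\le G_{\mathrm o(a)}$ and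 $G_a^+\le G_{\mathrm e(a)}$ be the images in $\Gamma$ of $\phi_a$ and $\phi_{-a}$, let $\varphi_a:G_a^-\to G_a^+$ be the isomorphism $\phi_a(h)\mapsto\phi_{-a}(h)$, and let $\mathrm{Fix}\,a=\{x\in G_a^-\cap G_a^+:\varphi_a(x)=x\}$. The edge $a\in\mathcal A_X^+$ is $T$-separating if $a\in\mathcal A_T$ and non-$T$-separating otherwise. $(\mathcal G,X,T)$ is minimal if for each $T$-separating edge $a$ the subgroup $G_a^-=G_a^+$ is a proper subgroup of both $G_{\mathrm o(a)}$ and $G_{\mathrm e(a)}$. $Z$ denotes the centre. **Theorem (Centre of a graph of groups).** Let $(\mathcal G,X,T)$ be a minimal decomposed graph of groups with fundamental group $\Gamma$. (A) Unless $X$ has a single vertex and a single non-oriented edge $\{a,-a\}$, $$Z(\Gamma)=\Bigl(\bigcap_{s\in\mathcal S_X}Z(G_s)\Bigr)\cap\Bigl(\bigcap_{a\ \text{non-}T\text{-separating}}\mathrm{Fix}\,a\Bigr).$$ (B) If $X$ has a single vertex $s$ and a single non-oriented edge, with $a\in\mathcal A_X^+$, put $A=G_s$ and $t=t_a$. 1.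 If $G_a^-$ or $G_a^+$ is a proper subgroup of $A$, then $Z(\Gamma)=Z(A)\cap\mathrm{Fix}\,a$. 2. If $G_a^-=G_a^+=A$ and $\varphi_a$ has infinite order in $\mathrm{Out}(A)$, then $Z(\Gamma)=Z(A)\cap\mathrm{Fix}\,a$. 3. If $G_a^-=G_a^+=A$ and $\varphi_a$ has finite order $n\ge1$ in $\mathrm{Out}(A)$, then for every $a_0\in A$ such that $\varphi_a^n(x)=a_0xa_0^{-1}$ for all $x\in A$, $$Z(\Gamma)=\bigcup_{p\in\mathbb Z}t^{pn}\bigl(\mathrm{Fix}\,a\cap a_0^{\,p}Z(A)\bigr).$$ -/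

import Mathlib

/-- A graph (in the sense of Serre) with vertex set `V` and edge set `E`: every edge `a` has an
origin `o a`, an end `e a` and an opposite edge `inv a ≠ a`. -/
structure SerreGraph (V : Type*) (E : Type*) where
  o : E → V
  e : E → V
  inv : E → E
  inv_inv : ∀ a, inv (inv a) = a
  inv_ne : ∀ a, inv a ≠ a
  e_eq : ∀ a, e a = o (inv a)

namespace SerreGraph

variable {V E : Type*} (X : SerreGraph V E)

/-- `X.IsPath s l s'`: the list of edges `l` is a path with origin `s` and end `s'`
(the empty list is the trivial path at a vertex). -/
def IsPath : V → List E → V → Prop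
  | s, [], s' => s = s'
  | s, a :: l, s' => X.o a = s ∧ IsPath (X.e a) l s'

/-- No two consecutive edges of the path are opposite. -/
def IsReduced (l : List E) : Prop :=
  l.IsChain fun a b => a ≠ X.inv b

def Connected : Prop :=
  ∀ s s' : V, ∃ l, X.IsPath s l s'

/-- An orientation: a set of edges containing exactly one edge of each pair `{a, inv a}`. -/
def IsOrientation (P : Set E) : Prop :=
  ∀ a, Xor (a ∈ P) (X.inv a ∈ P)

/-- The set of edges `T` is the edge set of a maximal tree: it is stable under `inv`, and in the
subgraph with edge set `T` and all the vertices, any two vertices are joined by a unique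
reduced path. -/
def IsMaximalTree (T : Set E) : Prop :=
  (∀ a ∈ T, X.inv a ∈ T) ∧
    ∀ s s' : V, ∃! l : List E, X.IsPath s l s' ∧ X.IsReduced l ∧ ∀ a ∈ l, a ∈ T

end SerreGraph

universe u v w z

/-- A graph of groups: a connected oriented graph with vertex groups, edge groups `edgeGroup a`
for the positive edges `a`, and monomorphisms from `edgeGroup a` to the groups of the origin and
of the end of `a`. -/
structure GraphOfGroups (V : Type u) (E : Type v) extends SerreGraph V E where
  connected : toSerreGraph.Connected
  pos : Set E
  isOrientation : toSerreGraph.IsOrientation pos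
  vertexGroup : V → Type w
  [vertexGroupInst : ∀ s, Group (vertexGroup s)]
  edgeGroup : pos → Type z
  [edgeGroupInst : ∀ a, Group (edgeGroup a)]
  φo : ∀ a : pos, edgeGroup a →* vertexGroup (o a)
  φe : ∀ a : pos, edgeGroup a →* vertexGroup (e a)
  φo_injective : ∀ a, Function.Injective (φo a)
  φe_injective : ∀ a, Function.Injective (φe a)

attribute [instance] GraphOfGroups.vertexGroupInst GraphOfGroups.edgeGroupInst

/-- A decomposed graph of groups: a graph of groups together with a maximal tree
(given by its set of edges). -/
structure DecomposedGraphOfGroups (V : Type u) (E : Type v) extends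
    GraphOfGroups.{u, v, w, z} V E where
  tree : Set E
  isMaximalTree : toSerreGraph.IsMaximalTree tree

/-- The outer automorphism group is the quotient of `MulAut G` by this normal subgroup. -/
instance innerAut_normal (G : Type*) [Group G] : (MulAut.conj (G := G)).range.Normal where
  conj_mem := by
    rintro _ ⟨g, rfl⟩ f
    exact ⟨f g, by ext x; simp [MulAut.conj_apply]⟩

abbrev OuterAut (G : Type*) [Group G] : Type _ :=
  MulAut G ⧸ (MulAut.conj (G := G)).range

namespace DecomposedGraphOfGroups

variable {V : Type u} {E : Type v} (𝒢 : DecomposedGraphOfGroups.{u, v, w, z} V E)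

/-- The free product of all vertex groups and of the free group on the edges. -/
abbrev FreeProd : Type _ :=
  Monoid.Coprod (Monoid.CoprodI 𝒢.vertexGroup) (FreeGroup E)

def preVertex (s : V) : 𝒢.vertexGroup s →* 𝒢.FreeProd :=
  Monoid.Coprod.inl.comp Monoid.CoprodI.of

def preEdge (a : E) : 𝒢.FreeProd :=
  Monoid.Coprod.inr (FreeGroup.of a)

/-- The relators of the fundamental group:
`φₐ(h) = tₐ φ₋ₐ(h) tₐ⁻¹` for positive `a`, `t₋ₐ = tₐ⁻¹`, and `tₐ = 1` for `a` in the tree. -/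
def relators : Set 𝒢.FreeProd :=
  {x | ∃ (a : 𝒢.pos) (h : 𝒢.edgeGroup a),
      x = 𝒢.preVertex _ (𝒢.φo a h) *
        (𝒢.preEdge a * 𝒢.preVertex _ (𝒢.φe a h) * (𝒢.preEdge a)⁻¹)⁻¹} ∪
  {x | ∃ a : E, x = 𝒢.preEdge (𝒢.inv a) * 𝒢.preEdge a} ∪
  {x | ∃ a ∈ 𝒢.tree, x = 𝒢.preEdge a}

/-- The fundamental group of the decomposed graph of groups. -/
abbrev FundGroup : Type _ :=
  𝒢.FreeProd ⧸ Subgroup.normalClosure 𝒢.relators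

/-- The natural map of a vertex group to the fundamental group. -/
def vertexHom (s : V) : 𝒢.vertexGroup s →* 𝒢.FundGroup :=
  (QuotientGroup.mk' _).comp (𝒢.preVertex s)

/-- The element `tₐ` of the fundamental group. -/
def t (a : E) : 𝒢.FundGroup :=
  QuotientGroup.mk' _ (𝒢.preEdge a)

/-- The vertex subgroup `G_s` of the fundamental group. -/
def vertexSubgroup (s : V) : Subgroup 𝒢.FundGroup :=
  (𝒢.vertexHom s).range

/-- The centre of the vertex group `G_s`, as a subgroup of the fundamental group. -/
def vertexCenter (s : V) : Subgroup 𝒢.FundGroup :=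
  (Subgroup.center (𝒢.vertexGroup s)).map (𝒢.vertexHom s)

/-- The two maps of an edge group to the fundamental group,
through the origin and through the end of the edge. -/
def edgeHomO (a : 𝒢.pos) : 𝒢.edgeGroup a →* 𝒢.FundGroup :=
  (𝒢.vertexHom _).comp (𝒢.φo a)

def edgeHomE (a : 𝒢.pos) : 𝒢.edgeGroup a →* 𝒢.FundGroup :=
  (𝒢.vertexHom _).comp (𝒢.φe a)

/-- The edge subgroups `Gₐ⁻ ≤ G_{o(a)}` and `Gₐ⁺ ≤ G_{e(a)}` of the fundamental group. -/
def edgeSubgroupO (a : 𝒢.pos) : Subgroup 𝒢.FundGroup :=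
  (𝒢.edgeHomO a).range

def edgeSubgroupE (a : 𝒢.pos) : Subgroup 𝒢.FundGroup :=
  (𝒢.edgeHomE a).range

/-- `Fix a`: the elements of `Gₐ⁻ ∩ Gₐ⁺` fixed by the isomorphism `Gₐ⁻ → Gₐ⁺` that sends
`edgeHomO a h` to `edgeHomE a h` for every `h` in the edge group. -/
def fix (a : 𝒢.pos) : Subgroup 𝒢.FundGroup :=
  ((𝒢.edgeHomO a).eqLocus (𝒢.edgeHomE a)).map (𝒢.edgeHomO a)

/-- Minimality: for each positive edge in the tree, the edge subgroup is proper in both adjacent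
vertex subgroups. -/
def IsMinimal : Prop :=
  ∀ a : 𝒢.pos, (a : E) ∈ 𝒢.tree →
    𝒢.edgeSubgroupO a < 𝒢.vertexSubgroup (𝒢.o a) ∧
    𝒢.edgeSubgroupE a < 𝒢.vertexSubgroup (𝒢.e a)

/-- The graph has a single vertex and a single non-oriented edge `{a, inv a}`. -/
def IsSingleLoop : Prop :=
  (∃ s : V, ∀ s', s' = s) ∧ ∃ a : E, ∀ b, b = a ∨ b = 𝒢.inv a

variable {𝒢} in
theorem IsSingleLoop.e_eq_o (hs : 𝒢.IsSingleLoop) (a : E) : 𝒢.e a = 𝒢.o a := by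
  obtain ⟨⟨s, h⟩, -⟩ := hs
  rw [h (𝒢.e a), h (𝒢.o a)]

/-- The identity map between the groups of two equal vertices. -/
def castVertex {s s' : V} (h : s = s') : 𝒢.vertexGroup s ≃* 𝒢.vertexGroup s' :=
  h ▸ MulEquiv.refl (𝒢.vertexGroup s)

/-- For a loop `a` both of whose monomorphisms to the vertex group are onto, the automorphism
`φₐ(h) ↦ φ₋ₐ(h)` of the vertex group. -/
noncomputable def loopAut (a : 𝒢.pos) (hloop : 𝒢.e a = 𝒢.o a)
    (ho : Function.Surjective (𝒢.φo a)) (he : Function.Surjective (𝒢.φe a)) :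
    MulAut (𝒢.vertexGroup (𝒢.o a)) :=
  (MulEquiv.ofBijective (𝒢.φo a) ⟨𝒢.φo_injective a, ho⟩).symm.trans
    ((MulEquiv.ofBijective (𝒢.φe a) ⟨𝒢.φe_injective a, he⟩).trans
      (𝒢.castVertex hloop))

end DecomposedGraphOfGroups

/-! One inclusion is formal: an element in all vertex centres and fixed along the remaining edges
commutes with a generating set of Γ. For the other, let `z` be central, fix a positive edge `b` and
put C = G_b⁻. Instead of normal forms in Γ, the proof uses those of the HNN extension H of Γ whose
stable letter `t` centralizes C. Multiplying t_b by `t` respects the edge relation of `b`, and after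
conjugating the vertex groups so that tree letters become trivial again it defines f : Γ → H
(`exists_stableLift`). Killing `t` is a left inverse of f, so f(z) ∈ C forces z ∈ C. Moreover f(z)
commutes with the whole image of f.

If `b` is in the tree, minimality gives g ∈ G_{o(b)} and k ∈ G_{e(b)} outside C. Then f(z) commutes
with g and tkt⁻¹, so it lies in C (`mem_of_commute_of_ne`). If `b` is not in the tree, f(z) commutes
with t·t_b. Then it lies in C, or else C and its conjugate by t_b⁻¹ contain all vertex groups and C
contains the letters of all other positive edges (`mem_or_of_commute_t_mul_of`). Without tree edges
the latter forces a single loop; with one, z already lies in a vertex group, hence in C. Thus,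
outside the single-loop case, z lies in every edge subgroup. Centrality then makes it fixed, and
injectivity of the vertex groups puts it in their centres.

For a single loop with both monomorphisms onto, every element is t_a^m c, and centrality reduces to
φ(c) = c and φ^m = conj c. -/

/-! ### Length of normal forms in an HNN extension with centralizing stable letter. -/

/-- The HNN extension of `G` whose stable letter commutes with the subgroup `C`. -/
abbrev CentralHNN (G : Type*) [Group G] (C : Subgroup G) : Type _ :=
  HNNExtension G C C (MulEquiv.refl C)

namespace CentralHNN

open HNNExtension HNNExtension.NormalWord

variable {G : Type*} [Group G] {C : Subgroup G}

theorem toSubgroup_eq (u : ℤˣ) : toSubgroup C C u = C := by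
  unfold toSubgroup; split_ifs <;> rfl

/-- A choice of normal forms. -/
noncomputable def transversal (C : Subgroup G) : TransversalPair G C C :=
  (TransversalPair.nonempty G C C).some

/-- The normal form of an element. -/
noncomputable def nf (x : CentralHNN G C) : NormalWord (transversal C) :=
  NormalWord.equiv (MulEquiv.refl C) (transversal C) x

/-- The number of occurrences of the stable letter in the normal form. -/
noncomputable def len (x : CentralHNN G C) : ℕ := (nf x).toList.length

theorem nf_of_mul (g : G) (x : CentralHNN G C) : nf (of g * x) = g • nf x := by
  change (of g * x : CentralHNN G C) • (empty : NormalWord (transversal C)) = _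
  rw [mul_smul, of_smul_eq_smul]; rfl

theorem nf_t_mul (u : ℤˣ) (x : CentralHNN G C) :
    nf ((t : CentralHNN G C) ^ (u : ℤ) * x) = unitsSMul (MulEquiv.refl C) u (nf x) := by
  change ((t : CentralHNN G C) ^ (u : ℤ) * x) • (empty : NormalWord (transversal C)) = _
  rw [mul_smul, t_pow_smul_eq_unitsSMul]; rfl

theorem prod_nf (x : CentralHNN G C) : (nf x).prod (MulEquiv.refl C) = x :=
  (NormalWord.equiv (MulEquiv.refl C) (transversal C)).left_inv x

@[simp]
theorem len_of_mul (g : G) (x : CentralHNN G C) : len (of g * x) = len x := by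
  simp [len, nf_of_mul]

theorem length_unitsSMul_of_cancels (d : TransversalPair G C C) (u : ℤˣ) (w : NormalWord d)
    (h : Cancels u w) :
    (unitsSMul (MulEquiv.refl C) u w).toList.length + 1 = w.toList.length := by
  rw [unitsSMul, dif_pos h]
  induction w using consRecOn with
  | ofGroup => simp [Cancels, ofGroup] at h
  | cons g u' w h1 h2 _ =>
    change ((toSubgroupEquiv (MulEquiv.refl C) u ⟨g, h.1⟩ : G) • w).toList.length + 1 = _
    simp [cons]

theorem length_unitsSMul_of_not_cancels (d : TransversalPair G C C) (u : ℤˣ) (w : NormalWord d)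
    (h : ¬ Cancels u w) :
    (unitsSMul (MulEquiv.refl C) u w).toList.length = w.toList.length + 1 := by
  rw [unitsSMul, dif_neg h]
  simp [cons]

theorem len_of_cancels {u : ℤˣ} {g : G} {x : CentralHNN G C} (h : Cancels u (g • nf x)) :
    len ((t : CentralHNN G C) ^ (u : ℤ) * (of g * x)) + 1 = len x := by
  rw [len, nf_t_mul, nf_of_mul, length_unitsSMul_of_cancels _ _ _ h]; rfl

theorem len_of_not_cancels {u : ℤˣ} {g : G} {x : CentralHNN G C} (h : ¬ Cancels u (g • nf x)) :
    len ((t : CentralHNN G C) ^ (u : ℤ) * (of g * x)) = len x + 1 := by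
  rw [len, nf_t_mul, nf_of_mul, length_unitsSMul_of_not_cancels _ _ _ h]; rfl

theorem len_t_mul_le (u : ℤˣ) (x : CentralHNN G C) :
    len ((t : CentralHNN G C) ^ (u : ℤ) * x) ≤ len x + 1 := by
  by_cases h : Cancels u ((1 : G) • nf x)
  · have := len_of_cancels h
    simp only [map_one, one_mul] at this; omega
  · have := len_of_not_cancels h
    simp only [map_one, one_mul] at this; omega

theorem len_of (g : G) : len (of g : CentralHNN G C) = 0 := by
  have : len (of g * 1 : CentralHNN G C) = 0 := by
    rw [len_of_mul]
    change ((1 : CentralHNN G C) • (empty : NormalWord (transversal C))).toList.length = 0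
    simp
  simpa using this

theorem exists_eq_of_of_len_eq_zero {x : CentralHNN G C} (h : len x = 0) : ∃ g, x = of g := by
  refine ⟨(nf x).head, ?_⟩
  conv_lhs => rw [← prod_nf x]
  simp [ReducedWord.prod, List.length_eq_zero_iff.1 h]

theorem exists_shrink {x : CentralHNN G C} (h : len x ≠ 0) :
    ∃ (u : ℤˣ) (g : G), len ((t : CentralHNN G C) ^ (u : ℤ) * (of g * x)) + 1 = len x := by
  obtain ⟨⟨u, a⟩, l, hl⟩ : ∃ a l, (nf x).toList = a :: l :=
    List.exists_cons_of_ne_nil fun h' => h (by simp [len, h'])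
  -- The normal form begins with `head * t ^ u`; this multiplier removes exactly that syllable.
  refine ⟨-u, (nf x).head⁻¹, len_of_cancels ⟨?_, ?_⟩⟩
  · simp
  · simp [hl]

/-- The first syllable of a normal form is well defined modulo `C`. -/
theorem shrink_unique {x : CentralHNN G C} {u v : ℤˣ} {g f : G}
    (hu : len ((t : CentralHNN G C) ^ (u : ℤ) * (of g * x)) ≤ len x)
    (hv : len ((t : CentralHNN G C) ^ (v : ℤ) * (of f * x)) ≤ len x) :
    u = v ∧ f * g⁻¹ ∈ C := by
  have h1 : Cancels u (g • nf x) := by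
    by_contra h; have := len_of_not_cancels h; omega
  have h2 : Cancels v (f • nf x) := by
    by_contra h; have := len_of_not_cancels h; omega
  refine ⟨?_, ?_⟩
  · have := h1.2.symm.trans h2.2
    simpa using this
  · have a1 := h1.1
    have a2 := h2.1
    rw [toSubgroup_eq] at a1 a2
    have := C.mul_mem a2 (C.inv_mem a1)
    simpa [mul_assoc] using this

theorem len_mul_le (x y : CentralHNN G C) : len (x * y) ≤ len x + len y := by
  induction hn : len x generalizing x with
  | zero =>
    obtain ⟨g, rfl⟩ := exists_eq_of_of_len_eq_zero hn
    simp
  | succ n ih =>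
    obtain ⟨u, g, h⟩ := exists_shrink (x := x) (by omega)
    have h2 := ih _ (by omega : len ((t : CentralHNN G C) ^ (u : ℤ) * (of g * x)) = n)
    have h3 := len_t_mul_le (-u) ((t : CentralHNN G C) ^ (u : ℤ) * (of g * x) * y)
    have : x * y = of g⁻¹ * ((t : CentralHNN G C) ^ ((-u : ℤˣ) : ℤ) *
        ((t : CentralHNN G C) ^ (u : ℤ) * (of g * x) * y)) := by
      simp [mul_assoc]
    rw [this, len_of_mul]; omega

theorem len_t_le (u : ℤˣ) : len ((t : CentralHNN G C) ^ (u : ℤ)) ≤ 1 := by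
  have := len_t_mul_le u (of (1 : G) : CentralHNN G C)
  rw [len_of] at this
  simpa using this

theorem len_inv_le (x : CentralHNN G C) : len x⁻¹ ≤ len x := by
  induction hn : len x generalizing x with
  | zero =>
    obtain ⟨g, rfl⟩ := exists_eq_of_of_len_eq_zero hn
    rw [← map_inv, len_of]
  | succ n ih =>
    obtain ⟨u, g, h⟩ := exists_shrink (x := x) (by omega)
    have h2 := ih _ (by omega : len ((t : CentralHNN G C) ^ (u : ℤ) * (of g * x)) = n)
    have h3 := len_mul_le (((t : CentralHNN G C) ^ (u : ℤ) * (of g * x))⁻¹)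
      ((t : CentralHNN G C) ^ (u : ℤ) * of g)
    have h4 := len_mul_le ((t : CentralHNN G C) ^ (u : ℤ)) (of g)
    have h5 := len_t_le (G := G) (C := C) u
    have : x⁻¹ = ((t : CentralHNN G C) ^ (u : ℤ) * (of g * x))⁻¹ *
      ((t : CentralHNN G C) ^ (u : ℤ) * of g) := by group
    rw [len_of] at h4
    rw [this]; omega

theorem len_inv (x : CentralHNN G C) : len x⁻¹ = len x :=
  le_antisymm (len_inv_le x) (by simpa using len_inv_le x⁻¹)

@[simp]
theorem len_mul_of (x : CentralHNN G C) (g : G) : len (x * of g) = len x := by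
  rw [← len_inv, mul_inv_rev, ← map_inv, len_of_mul, len_inv]

theorem len_mul_t_mul_of_le (x : CentralHNN G C) (u : ℤˣ) (g : G) :
    len (x * ((t : CentralHNN G C) ^ (u : ℤ) * of g)) ≤ len x + 1 := by
  have h1 := len_mul_le x ((t : CentralHNN G C) ^ (u : ℤ) * of g)
  have h2 := len_t_le (G := G) (C := C) u
  rw [len_mul_of] at h1; omega

theorem shrink_unique' {x : CentralHNN G C} {u v : ℤˣ} {g : G}
    (hu : len ((t : CentralHNN G C) ^ (u : ℤ) * (of g * x)) ≤ len x)
    (hv : len ((t : CentralHNN G C) ^ (v : ℤ) * x) ≤ len x) :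
    u = v ∧ g ∈ C := by
  have := shrink_unique (f := 1) hu (by simpa using hv)
  simpa using this

/-! ### Centralizers in this HNN extension. -/

/-- Right multiplication by `of h` does not disturb the shortening of `x`, so both `g` and `g * h`
shorten `of h * x = x * of h` to first order; uniqueness of the first syllable compares them modulo
`C`. -/
theorem conj_mem_of_commute {x : CentralHNN G C} {u : ℤˣ} {g h : G}
    (hu : len ((t : CentralHNN G C) ^ (u : ℤ) * (of g * x)) ≤ len x)
    (hc : Commute (of h) x) : g * h * g⁻¹ ∈ C := by
  refine (shrink_unique (v := u) hu ?_).2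
  rw [map_mul, mul_assoc (of g), hc.eq, ← mul_assoc (of g), ← mul_assoc, len_mul_of]
  exact hu

/-- Were the length 0, neither `t ^ u` nor its inverse would lengthen `of g`, and uniqueness of the
first syllable would give `u = -u`. -/
theorem len_t_mul_of (u : ℤˣ) (g : G) : len ((t : CentralHNN G C) ^ (u : ℤ) * of g) = 1 := by
  by_contra h
  have h0 : len ((t : CentralHNN G C) ^ (u : ℤ) * (of 1 * of g)) ≤ len (of g : CentralHNN G C) := by
    have := len_t_le (G := G) (C := C) u
    rw [len_mul_of] at h
    rw [map_one, one_mul, len_mul_of, len_of]; omega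
  have hx : len ((t : CentralHNN G C) ^ ((-u : ℤˣ) : ℤ) * (of 1 * of g)) ≤
      len (of g : CentralHNN G C) := by
    have h1 : len ((t : CentralHNN G C) ^ (u : ℤ)) = 0 := by
      simpa [len_of] using h0
    have : (t : CentralHNN G C) ^ ((-u : ℤˣ) : ℤ) = ((t : CentralHNN G C) ^ (u : ℤ))⁻¹ := by simp
    rw [map_one, one_mul, len_mul_of, len_of, this, len_inv, h1]
  have := (shrink_unique h0 hx).1
  simp at this

/-- If `x` has positive length, commuting with `h ∉ C` forces its first syllable outside the coset
of `t` and `t⁻¹`. Then `t k t⁻¹ x` is reduced and begins with `t`, while `x t k t⁻¹` begins like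
`x`, a contradiction. In length 0 the same comparison puts `x` in `C`. -/
theorem mem_of_commute_of_ne {x : CentralHNN G C} {h k : G} (hh : h ∉ C) (hk : k ∉ C)
    (hx : Commute (of h) x) (kx : Commute (t * of k * t⁻¹) x) : ∃ c ∈ C, x = of c := by
  have e1 : (t : CentralHNN G C) ^ ((1 : ℤˣ) : ℤ) = t := by simp
  have e2 : (t : CentralHNN G C) ^ ((-1 : ℤˣ) : ℤ) = t⁻¹ := by simp
  -- it is enough to see that `t⁻¹` and `x` have a common first syllable
  have key : len ((t : CentralHNN G C)⁻¹ * x) = len x + 1 →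
      len (t * of k * t⁻¹ * x) = len x + 2 ∧
      len ((t : CentralHNN G C) ^ ((-1 : ℤˣ) : ℤ) * (t * of k * t⁻¹ * x)) ≤ len x + 1 := by
    intro hl
    have a1 : len (of k * ((t : CentralHNN G C)⁻¹ * x)) = len x + 1 := by rw [len_of_mul, hl]
    have a2 : len ((t : CentralHNN G C) ^ ((1 : ℤˣ) : ℤ) *
        (of k⁻¹ * (of k * ((t : CentralHNN G C)⁻¹ * x)))) ≤
        len (of k * ((t : CentralHNN G C)⁻¹ * x)) := by
      rw [a1, e1]; simp
    have a3 := len_t_mul_le 1 (of k * ((t : CentralHNN G C)⁻¹ * x))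
    have a4 : ¬ len ((t : CentralHNN G C) ^ ((1 : ℤˣ) : ℤ) *
        (of k * ((t : CentralHNN G C)⁻¹ * x))) ≤ len (of k * ((t : CentralHNN G C)⁻¹ * x)) :=
      fun a4 => hk (by simpa using (shrink_unique' a2 a4).2)
    have a5 : t * of k * t⁻¹ * x = (t : CentralHNN G C) ^ ((1 : ℤˣ) : ℤ) *
        (of k * ((t : CentralHNN G C)⁻¹ * x)) := by rw [e1]; group
    refine ⟨by rw [a5]; omega, ?_⟩
    have : (t : CentralHNN G C) ^ ((-1 : ℤˣ) : ℤ) * (t * of k * t⁻¹ * x) =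
      of k * ((t : CentralHNN G C)⁻¹ * x) := by rw [e2]; group
    rw [this, a1]
  by_cases h0 : len x = 0
  · obtain ⟨c, rfl⟩ := exists_eq_of_of_len_eq_zero h0
    refine ⟨c, ?_, rfl⟩
    have l1 : len ((t : CentralHNN G C)⁻¹ * of c) = 1 := by rw [← e2, len_t_mul_of]
    obtain ⟨b1, b2⟩ := key (by rw [l1, h0])
    rw [h0] at b1 b2
    rw [kx.eq] at b1 b2
    refine inv_mem_iff.1 (shrink_unique' (u := -1) (g := c⁻¹) (v := -1) ?_ (b2.trans ?_)).2
    · rw [b1, e2]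
      have : (t : CentralHNN G C)⁻¹ * (of c⁻¹ * (of c * (t * of k * t⁻¹))) = of k * t⁻¹ := by
        simp [mul_assoc]
      rw [this, len_of_mul, ← e2]
      exact (len_t_le _).trans (by omega)
    · rw [b1]; omega
  · exfalso
    obtain ⟨u, g, hg⟩ := exists_shrink h0
    have hgC : g ∉ C := fun hgC => hh (by
      have := conj_mem_of_commute (by omega) hx (u := u) (g := g)
      rwa [C.mul_mem_cancel_right (C.inv_mem hgC), C.mul_mem_cancel_left hgC] at this)
    have l1 : len ((t : CentralHNN G C)⁻¹ * x) = len x + 1 := by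
      have a1 := len_t_mul_le (-1) x
      have a2 : ¬ len ((t : CentralHNN G C) ^ ((-1 : ℤˣ) : ℤ) * x) ≤ len x :=
        fun a2 => hgC (shrink_unique' (u := u) (g := g) (by omega) a2).2
      rw [e2] at a1 a2; omega
    obtain ⟨b1, b2⟩ := key l1
    refine hgC (shrink_unique' (x := t * of k * t⁻¹ * x) (u := u) (v := -1) ?_ (by omega)).2
    rw [b1, kx.eq, ← mul_assoc (of g), ← mul_assoc]
    have c1 := len_mul_le ((t : CentralHNN G C) ^ (u : ℤ) * (of g * x)) (t * of k * t⁻¹)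
    have c2 := len_mul_le ((t : CentralHNN G C) * of k) t⁻¹
    have c3 := len_t_le (G := G) (C := C) 1
    rw [e1] at c3
    rw [len_mul_of, len_inv] at c2
    omega

/-- If `t s x` is longer than `x`, it begins with `t`; being also `x t s`, it begins like `x`.
Otherwise `t s` cancels against the first syllable of `x`. -/
theorem shrink_of_commute_t_mul_of {x : CentralHNN G C} {g s : G} {u : ℤˣ}
    (hs : Commute (t * of s) x)
    (hg : len ((t : CentralHNN G C) ^ (u : ℤ) * (of g * x)) + 1 = len x) :
    (len x < len (t * of s * x) ∧ u = -1 ∧ g ∈ C) ∨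
      (len (t * of s * x) ≤ len x ∧ u = 1 ∧ s * g⁻¹ ∈ C) := by
  have e1 : (t : CentralHNN G C) ^ ((1 : ℤˣ) : ℤ) = t := by simp
  have e2 : (t : CentralHNN G C) ^ ((-1 : ℤˣ) : ℤ) = t⁻¹ := by simp
  rcases le_or_gt (len (t * of s * x)) (len x) with h | h
  · refine Or.inr ⟨h, shrink_unique (x := x) (u := u) (g := g) (v := 1) (by omega) ?_⟩
    rwa [e1, ← mul_assoc]
  · refine Or.inl ⟨h, shrink_unique' (x := t * of s * x) ?_ ?_⟩
    · have c1 := len_mul_t_mul_of_le ((t : CentralHNN G C) ^ (u : ℤ) * (of g * x)) 1 s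
      rw [hs.eq, ← mul_assoc (of g), ← mul_assoc, ← hs.eq]
      rw [e1] at c1
      omega
    · rw [e2, mul_assoc, inv_mul_cancel_left, len_of_mul, ← mul_assoc]; exact h.le

/-- An `x` of positive length runs along the axis of `t s` in one direction and `x⁻¹` in the other.
Their first syllables therefore give the two different conditions on `h`. -/
theorem mem_or_of_commute_t_mul_of {x : CentralHNN G C} {s : G} (hs : Commute (t * of s) x) :
    (∃ c ∈ C, x = of c) ∨ ∀ h, Commute (of h) x → h ∈ C ∧ s * h * s⁻¹ ∈ C := by
  have e1 : (t : CentralHNN G C) ^ ((1 : ℤˣ) : ℤ) = t := by simp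
  have e2 : (t : CentralHNN G C) ^ ((-1 : ℤˣ) : ℤ) = t⁻¹ := by simp
  by_cases h0 : len x = 0
  · left
    obtain ⟨c, rfl⟩ := exists_eq_of_of_len_eq_zero h0
    refine ⟨c, ?_, rfl⟩
    have l1 : len (t * of s * of c : CentralHNN G C) = 1 := by
      rw [mul_assoc, ← map_mul, ← e1, len_t_mul_of]
    refine inv_mem_iff.1 (shrink_unique' (x := t * of s * of c) (u := -1) (g := c⁻¹) (v := -1)
      ?_ ?_).2
    · rw [hs.eq, e2]
      have : (t : CentralHNN G C)⁻¹ * (of c⁻¹ * (of c * (t * of s))) = of s := by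
        simp
      rw [this, len_of]; omega
    · rw [e2, mul_assoc, inv_mul_cancel_left, ← map_mul, len_of]; omega
  · right
    intro h hh
    obtain ⟨u, g, hg⟩ := exists_shrink h0
    obtain ⟨v, f, hf⟩ := exists_shrink (x := x⁻¹) (by rwa [len_inv])
    have i1 : g * h * g⁻¹ ∈ C := conj_mem_of_commute (by omega) hh (u := u)
    have i2 : f * h * f⁻¹ ∈ C := conj_mem_of_commute (by omega) hh.inv_right (u := v)
    -- the two ways in which an element of `C` arises
    have m1 : ∀ r, r * h * r⁻¹ ∈ C → r ∈ C → h ∈ C := fun r h1 h2 => by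
      rwa [C.mul_mem_cancel_right (C.inv_mem h2), C.mul_mem_cancel_left h2] at h1
    have m2 : ∀ r, r * h * r⁻¹ ∈ C → s * r⁻¹ ∈ C → s * h * s⁻¹ ∈ C := fun r h1 h2 => by
      have := C.mul_mem (C.mul_mem h2 h1) (C.inv_mem h2)
      have e : s * r⁻¹ * (r * h * r⁻¹) * (s * r⁻¹)⁻¹ = s * h * s⁻¹ := by group
      rwa [e] at this
    -- `x (ts)⁻¹ = (ts)⁻¹ x`, and the letter `s⁻¹` in front does not count.
    have l2 : len (t * of s * x⁻¹) = len ((t : CentralHNN G C)⁻¹ * x) := by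
      rw [← len_inv, mul_inv_rev, inv_inv, ← hs.inv_left.eq, mul_inv_rev, mul_assoc, ← map_inv,
        len_of_mul]
    -- By `l2`, if both or neither of `x`, `x⁻¹` are lengthened by `t s`, the behaviour of `t⁻¹ x`
    -- contradicts the first syllable of `x`; only the mixed cases survive.
    rcases shrink_of_commute_t_mul_of hs hg with ⟨a1, a2, a3⟩ | ⟨a1, a2, a3⟩ <;>
      rcases shrink_of_commute_t_mul_of hs.inv_right hf with ⟨b1, b2, b3⟩ | ⟨b1, b2, b3⟩
    · exfalso
      rw [l2, len_inv] at b1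
      subst a2
      have : t⁻¹ * (of g * x) = of g * (t⁻¹ * x) := by
        rw [← mul_assoc, ← mul_assoc]
        congr 1
        exact inv_t_mul_of (φ := MulEquiv.refl C) ⟨g, a3⟩
      rw [e2, this, len_of_mul] at hg
      omega
    · exact ⟨m1 g i1 a3, m2 f i2 b3⟩
    · exact ⟨m1 f i2 b3, m2 g i1 a3⟩
    · exfalso
      rw [l2, len_inv] at b1
      have := (shrink_unique' (x := x) (u := u) (g := g) (v := -1) (by omega) (by rwa [e2])).1
      rw [a2] at this
      exact absurd this (by decide)

end CentralHNN

/-! ### Path reduction and potentials on a maximal tree. -/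

namespace SerreGraph

variable {V E : Type*} (X : SerreGraph V E)

theorem IsPath.append {s s' : V} {l : List E} (h : X.IsPath s l s') (a : E) (ha : X.o a = s') :
    X.IsPath s (l ++ [a]) (X.e a) := by
  induction l generalizing s with
  | nil => obtain rfl : s = s' := h; exact ⟨ha, rfl⟩
  | cons b l ih => exact ⟨h.1, ih h.2⟩

/-- Every path can be reduced without changing its ends, without using new edges, and without
changing the product of any labelling of the edges by group elements that is compatible
with `inv`. -/
theorem exists_reduced {H : Type*} [Group H] {σ : E → H} (hσ : ∀ a, σ (X.inv a) = (σ a)⁻¹)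
    {s s' : V} {l : List E} (h : X.IsPath s l s') :
    ∃ l', X.IsPath s l' s' ∧ X.IsReduced l' ∧ l' ⊆ l ∧ (l'.map σ).prod = (l.map σ).prod := by
  induction l generalizing s with
  | nil => exact ⟨[], h, List.isChain_nil, List.Subset.refl _, rfl⟩
  | cons a l ih =>
    obtain ⟨l', h1, h2, h3, h4⟩ := ih h.2
    have key : ∀ hred : X.IsReduced (a :: l'), ∃ l', X.IsPath s l' s' ∧ X.IsReduced l' ∧
        l' ⊆ a :: l ∧ (l'.map σ).prod = ((a :: l).map σ).prod := fun hred =>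
      ⟨a :: l', ⟨h.1, h1⟩, hred, List.cons_subset_cons a h3, by simp [h4]⟩
    match l', h1, h2, h3, h4, key with
    | [], _, _, _, _, key => exact key (List.isChain_singleton _)
    | b :: l'', h1, h2, h3, h4, key =>
      by_cases hab : a = X.inv b
      · have hb : b = X.inv a := by rw [hab, X.inv_inv]
        refine ⟨l'', ?_, (List.isChain_cons.1 h2).2, ?_, ?_⟩
        · have := h1.2
          rwa [X.e_eq, ← hab, h.1] at this
        · exact fun x hx => List.mem_cons_of_mem _ (h3 (List.mem_cons_of_mem _ hx))
        · rw [List.map_cons, List.prod_cons, ← h4, List.map_cons, List.prod_cons, hb, hσ]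
          simp
      · exact key (List.isChain_cons_cons.2 ⟨hab, h2⟩)

/-- A labelling of the edges by group elements is a coboundary on a maximal tree. -/
theorem IsMaximalTree.exists_potential {X : SerreGraph V E} {T : Set E} (hT : X.IsMaximalTree T)
    {H : Type*} [Group H] {σ : E → H} (hσ : ∀ a, σ (X.inv a) = (σ a)⁻¹) (s₀ : V) :
    ∃ γ : V → H, γ s₀ = 1 ∧ (∀ a ∈ T, γ (X.e a) = γ (X.o a) * σ a) ∧
      ∀ S : Subgroup H, (∀ a ∈ T, σ a ∈ S) → ∀ s, γ s ∈ S := by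
  choose p hp hu using fun s => hT.2 s₀ s
  have key : ∀ s l, X.IsPath s₀ l s → (∀ a ∈ l, a ∈ T) →
      (l.map σ).prod = ((p s).map σ).prod := by
    intro s l hl hlT
    obtain ⟨l', h1, h2, h3, h4⟩ := X.exists_reduced hσ hl
    rw [← h4, hu s l' ⟨h1, h2, fun a ha => hlT a (h3 ha)⟩]
  -- The potential is the product of labels along the reduced tree path from `s₀`; by `key`, any
  -- other tree path gives the same value.
  refine ⟨fun s => ((p s).map σ).prod, ?_, fun a ha => ?_, fun S hS s => ?_⟩
  · exact (key s₀ [] rfl (by simp)).symm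
  · have := key (X.e a) (p (X.o a) ++ [a]) ((hp _).1.append X a rfl) (by
      intro b hb
      rcases List.mem_append.1 hb with hb | hb
      · exact (hp _).2.2 b hb
      · rwa [List.mem_singleton.1 hb])
    simpa using this.symm
  · refine S.list_prod_mem fun x hx => ?_
    obtain ⟨a, ha, rfl⟩ := List.mem_map.1 hx
    exact hS a ((hp s).2.2 a ha)

end SerreGraph

/-! ### Conjugating embeddings by iterated HNN extensions. -/

/-- Finitely many pairs of embeddings into a group become conjugate in a larger group. -/
theorem exists_overgroup_conj {G : Type u} [Group G] {ι : Type*} [Finite ι] {H : ι → Type*}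
    [∀ i, Group (H i)] (α β : ∀ i, H i →* G) (hα : ∀ i, Function.Injective (α i))
    (hβ : ∀ i, Function.Injective (β i)) :
    ∃ (P : Type u) (_ : Group P) (j : G →* P), Function.Injective j ∧
      ∀ i, ∃ x : P, ∀ h, j (α i h) * x = x * j (β i h) := by
  classical
  cases nonempty_fintype ι
  suffices ∀ S : Finset ι, ∃ (P : Type u) (_ : Group P) (j : G →* P), Function.Injective j ∧
      ∀ i ∈ S, ∃ x : P, ∀ h, j (α i h) * x = x * j (β i h) by
    obtain ⟨P, hP, j, hj, h⟩ := this Finset.univ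
    exact ⟨P, hP, j, hj, fun i => h i (Finset.mem_univ i)⟩
  intro S
  induction S using Finset.induction_on with
  | empty => exact ⟨G, inferInstance, MonoidHom.id G, Function.injective_id, by simp⟩
  | insert i S _ ih =>
    obtain ⟨P, hP, j, hj, h⟩ := ih
    let φ : (j.comp (β i)).range ≃* (j.comp (α i)).range :=
      (MonoidHom.ofInjective (f := j.comp (β i)) (hj.comp (hβ i))).symm.trans
        (MonoidHom.ofInjective (f := j.comp (α i)) (hj.comp (hα i)))
    refine ⟨HNNExtension P _ _ φ, inferInstance, HNNExtension.of.comp j,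
      (HNNExtension.of_injective φ).comp hj, fun k hk => ?_⟩
    rcases Finset.mem_insert.1 hk with rfl | hk
    · refine ⟨HNNExtension.t, fun h => ?_⟩
      have := HNNExtension.t_mul_of (φ := φ)
        (MonoidHom.ofInjective (f := j.comp (β k)) (hj.comp (hβ k)) h)
      simpa only [φ, MulEquiv.trans_apply, MulEquiv.symm_apply_apply, MonoidHom.ofInjective_apply,
        MonoidHom.comp_apply] using this.symm
    · obtain ⟨x, hx⟩ := h k hk
      exact ⟨HNNExtension.of x, fun h => by
        simp only [MonoidHom.comp_apply, ← map_mul, hx]⟩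

/-! ### Universal property, generators, and injectivity of the vertex groups. -/

namespace DecomposedGraphOfGroups

variable {V : Type u} {E : Type v} (𝒢 : DecomposedGraphOfGroups.{u, v, w, z} V E)

variable {𝒢} in
/-- The universal property of the fundamental group. -/
def lift {H : Type*} [Group H] (ρ : ∀ s, 𝒢.vertexGroup s →* H) (θ : E → H)
    (h₁ : ∀ (a : 𝒢.pos) (h : 𝒢.edgeGroup a), ρ _ (𝒢.φo a h) * θ a = θ a * ρ _ (𝒢.φe a h))
    (h₂ : ∀ a, θ (𝒢.inv a) = (θ a)⁻¹) (h₃ : ∀ a ∈ 𝒢.tree, θ a = 1) : 𝒢.FundGroup →* H :=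
  QuotientGroup.lift _ (Monoid.Coprod.lift (Monoid.CoprodI.lift ρ) (FreeGroup.lift θ)) (by
    refine Subgroup.normalClosure_le_normal (N := MonoidHom.ker _) ?_
    rintro x ((⟨a, h, rfl⟩ | ⟨a, rfl⟩) | ⟨a, ha, rfl⟩)
    · have : ρ _ (𝒢.φo a h) = θ a * ρ _ (𝒢.φe a h) * (θ a)⁻¹ := eq_mul_inv_of_mul_eq (h₁ a h)
      simp [MonoidHom.mem_ker, preVertex, preEdge, this]
    · simp [MonoidHom.mem_ker, preEdge, h₂]
    · simp [MonoidHom.mem_ker, preEdge, h₃ a ha])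

section lift

variable {𝒢} {H : Type*} [Group H] (ρ : ∀ s, 𝒢.vertexGroup s →* H) (θ : E → H)
    (h₁ : ∀ (a : 𝒢.pos) (h : 𝒢.edgeGroup a), ρ _ (𝒢.φo a h) * θ a = θ a * ρ _ (𝒢.φe a h))
    (h₂ : ∀ a, θ (𝒢.inv a) = (θ a)⁻¹) (h₃ : ∀ a ∈ 𝒢.tree, θ a = 1)

@[simp]
theorem lift_vertexHom (s : V) (g : 𝒢.vertexGroup s) :
    lift ρ θ h₁ h₂ h₃ (𝒢.vertexHom s g) = ρ s g := by
  simp [lift, vertexHom, preVertex]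

@[simp]
theorem lift_t (a : E) : lift ρ θ h₁ h₂ h₃ (𝒢.t a) = θ a := by
  simp [lift, t, preEdge]

end lift

theorem t_inv (a : E) : 𝒢.t (𝒢.inv a) = (𝒢.t a)⁻¹ := by
  rw [eq_inv_iff_mul_eq_one]
  exact (QuotientGroup.eq_one_iff _).2 (Subgroup.subset_normalClosure (Or.inl (Or.inr ⟨a, rfl⟩)))

theorem t_eq_one {a : E} (ha : a ∈ 𝒢.tree) : 𝒢.t a = 1 :=
  (QuotientGroup.eq_one_iff _).2 (Subgroup.subset_normalClosure (Or.inr ⟨a, ha, rfl⟩))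

theorem edgeHomO_mul_t (a : 𝒢.pos) (h : 𝒢.edgeGroup a) :
    𝒢.edgeHomO a h * 𝒢.t a = 𝒢.t a * 𝒢.edgeHomE a h := by
  rw [← eq_mul_inv_iff_mul_eq, ← mul_inv_eq_one]
  exact (QuotientGroup.eq_one_iff _).2
    (Subgroup.subset_normalClosure (Or.inl (Or.inl ⟨a, h, rfl⟩)))

theorem pos_or_inv_pos (a : E) : a ∈ 𝒢.pos ∨ 𝒢.inv a ∈ 𝒢.pos := (𝒢.isOrientation a).or

theorem inv_notMem_pos {a : E} (ha : a ∈ 𝒢.pos) : 𝒢.inv a ∉ 𝒢.pos := fun h => by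
  rcases 𝒢.isOrientation a with h' | h'
  · exact h'.2 h
  · exact h'.2 ha

theorem inv_mem_tree_iff {a : E} : 𝒢.inv a ∈ 𝒢.tree ↔ a ∈ 𝒢.tree :=
  ⟨fun h => by simpa [𝒢.inv_inv] using 𝒢.isMaximalTree.1 _ h, 𝒢.isMaximalTree.1 a⟩

variable {𝒢} in
@[ext high]
theorem hom_ext {H : Type*} [Monoid H] {f g : 𝒢.FundGroup →* H}
    (h₁ : ∀ s x, f (𝒢.vertexHom s x) = g (𝒢.vertexHom s x)) (h₂ : ∀ a, f (𝒢.t a) = g (𝒢.t a)) :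
    f = g := by
  refine QuotientGroup.monoidHom_ext _ (Monoid.Coprod.hom_ext ?_ ?_)
  · exact Monoid.CoprodI.ext_hom _ _ fun s => MonoidHom.ext (h₁ s)
  · exact FreeGroup.ext_hom _ _ h₂

/-- The fundamental group is generated by the vertex groups and the letters of positive edges. -/
theorem eq_top_of_le {S : Subgroup 𝒢.FundGroup} (h₁ : ∀ s g, 𝒢.vertexHom s g ∈ S)
    (h₂ : ∀ a ∈ 𝒢.pos, a ∉ 𝒢.tree → 𝒢.t a ∈ S) : S = ⊤ := by
  have h₃ : ∀ a, 𝒢.t a ∈ S := fun a => by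
    by_cases hT : a ∈ 𝒢.tree
    · rw [𝒢.t_eq_one hT]; exact S.one_mem
    rcases 𝒢.pos_or_inv_pos a with h | h
    · exact h₂ a h hT
    · have := h₂ _ h (by rwa [inv_mem_tree_iff])
      rwa [t_inv, inv_mem_iff] at this
  let f : 𝒢.FundGroup →* S := lift (fun s => (𝒢.vertexHom s).codRestrict S (h₁ s))
    (fun a => ⟨𝒢.t a, h₃ a⟩)
    (fun a h => Subtype.ext (𝒢.edgeHomO_mul_t a h)) (fun a => Subtype.ext (𝒢.t_inv a))
    (fun a ha => Subtype.ext (𝒢.t_eq_one ha))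
  have hf : S.subtype.comp f = MonoidHom.id _ := hom_ext (by simp [f]) (by simp [f])
  refine eq_top_iff.2 fun x _ => ?_
  have := DFunLike.congr_fun hf x
  rw [MonoidHom.id_apply] at this
  rw [← this]
  exact (f x).2

variable {𝒢} in
/-- Homomorphisms from the fundamental group, with the letters of the tree not required
to be trivial. -/
theorem exists_twisted_lift {H : Type*} [Group H] (ρ : ∀ s, 𝒢.vertexGroup s →* H) (σ : E → H)
    (h₁ : ∀ (a : 𝒢.pos) (h : 𝒢.edgeGroup a), ρ _ (𝒢.φo a h) * σ a = σ a * ρ _ (𝒢.φe a h))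
    (h₂ : ∀ a, σ (𝒢.inv a) = (σ a)⁻¹) (s₀ : V) :
    ∃ (γ : V → H) (f : 𝒢.FundGroup →* H), γ s₀ = 1 ∧
      (∀ a ∈ 𝒢.tree, γ (𝒢.e a) = γ (𝒢.o a) * σ a) ∧
      (∀ S : Subgroup H, (∀ a ∈ 𝒢.tree, σ a ∈ S) → ∀ s, γ s ∈ S) ∧
      (∀ s g, f (𝒢.vertexHom s g) = γ s * ρ s g * (γ s)⁻¹) ∧
      ∀ a, f (𝒢.t a) = γ (𝒢.o a) * σ a * (γ (𝒢.e a))⁻¹ := by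
  obtain ⟨γ, hγ, hγT, hγS⟩ := 𝒢.isMaximalTree.exists_potential h₂ s₀
  -- Conjugating each `ρ s` by `γ s` makes the tree letters trivial.
  refine ⟨γ, lift (fun s => (MulAut.conj (γ s)).toMonoidHom.comp (ρ s))
    (fun a => γ (𝒢.o a) * σ a * (γ (𝒢.e a))⁻¹) (fun a h => ?_) (fun a => ?_) (fun a ha => ?_),
    hγ, hγT, hγS, fun s g => ?_, fun a => ?_⟩
  · have := h₁ a h
    simp only [MonoidHom.comp_apply, MulEquiv.toMonoidHom_eq_coe, MonoidHom.coe_coe,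
      MulAut.conj_apply, mul_assoc, inv_mul_cancel_left]
    rw [← mul_assoc (ρ _ _), this]
    simp [mul_assoc]
  · rw [h₂, 𝒢.e_eq (𝒢.inv a), 𝒢.inv_inv, ← 𝒢.e_eq]
    simp [mul_assoc]
  · rw [hγT a ha]; group
  · simp
  · simp

/-- It suffices to map Γ to some group so that `G_s` embeds. The product of all vertex groups
contains each of them, and a larger group realizes all edge isomorphisms by conjugations. Finiteness
of `E` keeps the iteration finite. -/
theorem vertexHom_injective [Finite E] (s : V) : Function.Injective (𝒢.vertexHom s) := by
  classical
  let ι : ∀ s, 𝒢.vertexGroup s →* (∀ s, 𝒢.vertexGroup s) := MonoidHom.mulSingle 𝒢.vertexGroup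
  have hι : ∀ s, Function.Injective (ι s) := fun s => Pi.mulSingle_injective s
  obtain ⟨P, _, j, hj, hx⟩ := exists_overgroup_conj (ι := 𝒢.pos)
    (fun a => (ι _).comp (𝒢.φo a)) (fun a => (ι _).comp (𝒢.φe a))
    (fun a => (hι _).comp (𝒢.φo_injective a)) (fun a => (hι _).comp (𝒢.φe_injective a))
  choose x hx using hx
  obtain ⟨γ, f, -, -, -, hf, -⟩ := exists_twisted_lift (𝒢 := 𝒢) (fun s => j.comp (ι s))
    (fun a => if h : a ∈ 𝒢.pos then x ⟨a, h⟩ else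
      if h : 𝒢.inv a ∈ 𝒢.pos then (x ⟨𝒢.inv a, h⟩)⁻¹ else 1)
    (fun a h => by simpa using hx a h)
    (fun a => by
      rcases 𝒢.pos_or_inv_pos a with h | h
      · simp [h, 𝒢.inv_notMem_pos h, 𝒢.inv_inv]
      · have := 𝒢.inv_notMem_pos h
        rw [𝒢.inv_inv] at this
        simp [h, this]) s
  refine Function.Injective.of_comp (f := f) fun g h hgh => ?_
  simp only [Function.comp_apply, hf, mul_left_inj, mul_right_inj] at hgh
  exact hι s (hj hgh)

/-! ### Lifting Γ to the HNN extension over an edge subgroup. -/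

section stableLift

variable {𝒢}

open HNNExtension (of) in
/-- The section of `CentralHNN 𝒢.FundGroup Gₐ⁻ → 𝒢.FundGroup` that multiplies the letter `tₐ`
by the stable letter. -/
theorem exists_stableLift (b : 𝒢.pos) :
    ∃ f : 𝒢.FundGroup →* CentralHNN 𝒢.FundGroup (𝒢.edgeSubgroupO b),
      (∀ x y, f x = of y → x = y) ∧
      (∀ g, f (𝒢.vertexHom (𝒢.o b) g) = of (𝒢.vertexHom _ g)) ∧
      ((b : E) ∈ 𝒢.tree →
        ∀ g, f (𝒢.vertexHom (𝒢.e b) g) = HNNExtension.t * of (𝒢.vertexHom _ g) * HNNExtension.t⁻¹) ∧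
      ((b : E) ∉ 𝒢.tree → (∀ s g, f (𝒢.vertexHom s g) = of (𝒢.vertexHom s g)) ∧
        f (𝒢.t b) = HNNExtension.t * of (𝒢.t b) ∧
        ∀ a : 𝒢.pos, a ≠ b → f (𝒢.t a) = of (𝒢.t a)) := by
  classical
  let C := 𝒢.edgeSubgroupO b
  let σ : E → CentralHNN 𝒢.FundGroup C := fun a =>
    if a = b then HNNExtension.t * of (𝒢.t b) else if a = 𝒢.inv b then (HNNExtension.t * of (𝒢.t b))⁻¹ else of (𝒢.t a)
  have hσb : σ b = HNNExtension.t * of (𝒢.t b) := by simp [σ]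
  have hσ : ∀ a : 𝒢.pos, a ≠ b → σ a = of (𝒢.t a) := by
    intro a ha
    have h1 : (a : E) ≠ b := fun h => ha (Subtype.ext h)
    have h2 : (a : E) ≠ 𝒢.inv b := fun h => 𝒢.inv_notMem_pos b.2 (h ▸ a.2)
    simp [σ, h1, h2]
  have hσT : ∀ a ∈ 𝒢.tree, (b : E) ∉ 𝒢.tree → σ a = 1 := by
    intro a ha hb
    have h1 : a ≠ b := fun h => hb (h ▸ ha)
    have h2 : a ≠ 𝒢.inv b := fun h => hb (by rwa [h, inv_mem_tree_iff] at ha)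
    simp [σ, h1, h2, 𝒢.t_eq_one ha]
  let π : CentralHNN 𝒢.FundGroup C →* 𝒢.FundGroup :=
    HNNExtension.lift (MonoidHom.id _) 1 (by simp)
  have hπt : π HNNExtension.t = 1 := HNNExtension.lift_t _ _ _
  have hπof : ∀ x, π (of x) = x := HNNExtension.lift_of _ _ _
  have hπσ : ∀ a, π (σ a) = 𝒢.t a := by
    intro a
    by_cases h1 : a = b
    · simp [σ, h1, hπt, hπof]
    by_cases h2 : a = 𝒢.inv b
    · rw [h2, t_inv]
      simp [σ, 𝒢.inv_ne, hπt, hπof]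
    · simp [σ, h1, h2, hπof]
  obtain ⟨γ, f, hγb, hγT, hγS, hfv, hft⟩ := exists_twisted_lift (𝒢 := 𝒢)
    (fun s => (of : _ →* CentralHNN 𝒢.FundGroup C).comp (𝒢.vertexHom s)) σ
    (fun a h => by
      have h1 := 𝒢.edgeHomO_mul_t a h
      change of (𝒢.edgeHomO a h) * σ a = σ a * of (𝒢.edgeHomE a h)
      by_cases hab : a = b
      -- The relation of `b` survives because the stable letter commutes with `Gₐ⁻`.
      · subst hab
        have h2 := HNNExtension.t_mul_of (φ := MulEquiv.refl C) ⟨𝒢.edgeHomO a h, h, rfl⟩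
        simp only [MulEquiv.refl_apply] at h2
        rw [hσb, mul_assoc, ← map_mul, ← h1, map_mul, ← mul_assoc, ← mul_assoc, h2]
      · rw [hσ a hab, ← map_mul, ← map_mul, h1])
    (fun a => by
      by_cases h1 : a = b
      · simp [σ, h1, 𝒢.inv_ne]
      by_cases h2 : a = 𝒢.inv b
      · simp [σ, h2, 𝒢.inv_ne, 𝒢.inv_inv]
      · have h3 : 𝒢.inv a ≠ b := fun h => h2 (by rw [← h, 𝒢.inv_inv])
        have h4 : 𝒢.inv a ≠ 𝒢.inv b := fun h => h1 (by rw [← 𝒢.inv_inv a, h, 𝒢.inv_inv])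
        simp [σ, h1, h2, h3, h4, t_inv]) (𝒢.o b)
  -- The labels of tree edges lie in `π.ker`, hence so does the potential; this makes `f` a section
  -- of `π`.
  have hπγ : ∀ s, π (γ s) = 1 :=
    hγS π.ker fun a ha => by rw [MonoidHom.mem_ker, hπσ, 𝒢.t_eq_one ha]
  have hπf : π.comp f = MonoidHom.id _ :=
    hom_ext (by simp [hfv, hπγ, hπof]) (by simp [hft, hπγ, hπσ])
  refine ⟨f, fun x y hxy => ?_, fun g => ?_, fun hb g => ?_, fun hb => ?_⟩
  · have := DFunLike.congr_fun hπf x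
    simpa [hxy, hπof] using this.symm
  · simp [hfv, hγb]
  · have : γ (𝒢.e b) = HNNExtension.t := by rw [hγT b hb, hγb, hσb, 𝒢.t_eq_one hb]; simp
    simp [hfv, this]
  · have hγ : ∀ s, γ s = 1 := hγS ⊥ fun a ha => hσT a ha hb
    refine ⟨?_, ?_, ?_⟩
    · simp [hfv, hγ]
    · simp [hft, hγ, hσb]
    · intro a hab
      simp [hft, hγ, hσ a hab]

end stableLift

end DecomposedGraphOfGroups

/-! ### Central elements and edge subgroups; the general case. -/

namespace DecomposedGraphOfGroups

variable {V : Type u} {E : Type v} {𝒢 : DecomposedGraphOfGroups.{u, v, w, z} V E}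

theorem conj_edgeHomE (a : 𝒢.pos) (h : 𝒢.edgeGroup a) :
    𝒢.t a * 𝒢.edgeHomE a h * (𝒢.t a)⁻¹ = 𝒢.edgeHomO a h := by
  rw [← edgeHomO_mul_t, mul_inv_cancel_right]

theorem edgeHomE_eq_of_mem_center {a : 𝒢.pos} {h : 𝒢.edgeGroup a}
    (hz : 𝒢.edgeHomO a h ∈ Subgroup.center 𝒢.FundGroup) : 𝒢.edgeHomE a h = 𝒢.edgeHomO a h := by
  have h1 := 𝒢.edgeHomO_mul_t a h
  rw [← Subgroup.mem_center_iff.1 hz] at h1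
  exact (mul_left_cancel h1).symm

theorem mem_fix_of_mem_center {a : 𝒢.pos} {z : 𝒢.FundGroup}
    (hz : z ∈ Subgroup.center 𝒢.FundGroup) (ha : z ∈ 𝒢.edgeSubgroupO a) : z ∈ 𝒢.fix a := by
  obtain ⟨h, rfl⟩ := ha
  exact ⟨h, (edgeHomE_eq_of_mem_center hz).symm, rfl⟩

theorem mem_vertexSubgroup_of_mem_center {a : 𝒢.pos} {z : 𝒢.FundGroup}
    (hz : z ∈ Subgroup.center 𝒢.FundGroup) (ha : z ∈ 𝒢.edgeSubgroupO a) :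
    z ∈ 𝒢.vertexSubgroup (𝒢.o a) ∧ z ∈ 𝒢.vertexSubgroup (𝒢.e a) := by
  obtain ⟨h, rfl⟩ := ha
  refine ⟨⟨_, rfl⟩, ?_⟩
  rw [← edgeHomE_eq_of_mem_center hz]
  exact ⟨_, rfl⟩

theorem mem_vertexCenter_of_mem_center [Finite E] {s : V} {z : 𝒢.FundGroup}
    (hz : z ∈ Subgroup.center 𝒢.FundGroup) (hs : z ∈ 𝒢.vertexSubgroup s) :
    z ∈ 𝒢.vertexCenter s := by
  obtain ⟨g, rfl⟩ := hs
  refine ⟨g, Subgroup.mem_center_iff.2 fun x => 𝒢.vertexHom_injective s ?_, rfl⟩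
  rw [map_mul, map_mul, Subgroup.mem_center_iff.1 hz]

/-- The easy inclusion of the theorem. -/
theorem mem_center_of_mem {z : 𝒢.FundGroup} (hv : ∀ s, z ∈ 𝒢.vertexCenter s)
    (hf : ∀ a : 𝒢.pos, (a : E) ∉ 𝒢.tree → z ∈ 𝒢.fix a) :
    z ∈ Subgroup.center 𝒢.FundGroup := by
  have : Subgroup.centralizer {z} = ⊤ := by
    refine 𝒢.eq_top_of_le (fun s g => ?_) (fun a ha haT => ?_)
    · rw [Subgroup.mem_centralizer_singleton_iff]
      obtain ⟨x, hx, rfl⟩ := hv s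
      rw [← map_mul, ← map_mul, Subgroup.mem_center_iff.1 hx]
    · rw [Subgroup.mem_centralizer_singleton_iff]
      obtain ⟨h, hh, rfl⟩ := hf ⟨a, ha⟩ haT
      rw [𝒢.edgeHomO_mul_t ⟨a, ha⟩ h]
      congr 1
  refine Subgroup.mem_center_iff.2 fun g => ?_
  have hg : g ∈ Subgroup.centralizer {z} := this ▸ Subgroup.mem_top g
  exact Subgroup.mem_centralizer_singleton_iff.1 hg

theorem mem_edgeSubgroupO_of_mem_tree (hmin : 𝒢.IsMinimal) {z : 𝒢.FundGroup}
    (hz : z ∈ Subgroup.center 𝒢.FundGroup) (b : 𝒢.pos) (hb : (b : E) ∈ 𝒢.tree) :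
    z ∈ 𝒢.edgeSubgroupO b := by
  obtain ⟨f, hf, hfo, hfe, -⟩ := exists_stableLift b
  have hc : ∀ x, Commute (f x) (f z) := fun x => by
    have : Commute x z := Subgroup.mem_center_iff.1 hz x
    exact this.map f
  obtain ⟨_, ⟨g, rfl⟩, hgC⟩ := SetLike.exists_of_lt (hmin b hb).1
  obtain ⟨_, ⟨k, rfl⟩, hkC⟩ := SetLike.exists_of_lt (hmin b hb).2
  -- For a tree edge t_b = 1, so both edge subgroups coincide.
  have hkC' : 𝒢.vertexHom _ k ∉ 𝒢.edgeSubgroupO b := by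
    rintro ⟨h, hh⟩
    refine hkC ⟨h, ?_⟩
    rw [← hh, ← conj_edgeHomE, 𝒢.t_eq_one hb]
    simp
  have h1 := hc (𝒢.vertexHom _ g)
  have h2 := hc (𝒢.vertexHom _ k)
  rw [hfo] at h1
  rw [hfe hb] at h2
  obtain ⟨c, hcC, hzc⟩ := CentralHNN.mem_of_commute_of_ne hgC hkC' h1 h2
  rwa [hf z c hzc]

theorem mem_edgeSubgroupO_or_of_notMem_tree {z : 𝒢.FundGroup}
    (hz : z ∈ Subgroup.center 𝒢.FundGroup) (b : 𝒢.pos) (hb : (b : E) ∉ 𝒢.tree) :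
    z ∈ 𝒢.edgeSubgroupO b ∨
      ((∀ s g, 𝒢.vertexHom s g ∈ 𝒢.edgeSubgroupO b ∧ 𝒢.vertexHom s g ∈ 𝒢.edgeSubgroupE b) ∧
        ∀ a : 𝒢.pos, a ≠ b → 𝒢.t a ∈ 𝒢.edgeSubgroupO b) := by
  obtain ⟨f, hf, -, -, hfb⟩ := exists_stableLift b
  obtain ⟨hfv, hft, hfa⟩ := hfb hb
  have hc : ∀ x, Commute (f x) (f z) := fun x => by
    have : Commute x z := Subgroup.mem_center_iff.1 hz x
    exact this.map f
  have h1 := hc (𝒢.t b)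
  rw [hft] at h1
  rcases CentralHNN.mem_or_of_commute_t_mul_of h1 with ⟨c, hcC, hzc⟩ | h2
  · left
    rwa [hf z c hzc]
  · right
    refine ⟨fun s g => ?_, fun a hab => ?_⟩
    · have h3 := hc (𝒢.vertexHom s g)
      rw [hfv] at h3
      refine ⟨(h2 _ h3).1, ?_⟩
      obtain ⟨h, hh⟩ := (h2 _ h3).2
      refine ⟨h, ?_⟩
      rw [← conj_edgeHomE] at hh
      exact mul_left_cancel (mul_right_cancel hh)
    · have h3 := hc (𝒢.t a)
      rw [hfa a hab] at h3
      exact (h2 _ h3).1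

/-- The exponent sum of t_b is a homomorphism to ℤ that kills all vertex groups and takes t_b to 1.
-/
theorem t_notMem_vertexSubgroup {b : 𝒢.pos} (hb : (b : E) ∉ 𝒢.tree) (s : V) :
    𝒢.t b ∉ 𝒢.vertexSubgroup s := by
  classical
  let f : 𝒢.FundGroup →* Multiplicative ℤ := lift (fun _ => 1)
    (fun a => if a = b then Multiplicative.ofAdd 1 else
      if a = 𝒢.inv b then (Multiplicative.ofAdd 1)⁻¹ else 1) (by simp)
    (fun a => by
      by_cases h1 : a = b
      · simp [h1, 𝒢.inv_ne]
      by_cases h2 : a = 𝒢.inv b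
      · simp [h2, 𝒢.inv_ne, 𝒢.inv_inv]
      · have h3 : 𝒢.inv a ≠ b := fun h => h2 (by rw [← h, 𝒢.inv_inv])
        have h4 : 𝒢.inv a ≠ 𝒢.inv b := fun h => h1 (by rw [← 𝒢.inv_inv a, h, 𝒢.inv_inv])
        simp [h1, h2, h3, h4])
    (fun a ha => by
      have h1 : a ≠ b := fun h => hb (h ▸ ha)
      have h2 : a ≠ 𝒢.inv b := fun h => hb (by rwa [h, inv_mem_tree_iff] at ha)
      simp [h1, h2])
  rintro ⟨g, hg⟩
  have h1 := congrArg f hg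
  simp only [f, lift_vertexHom, lift_t] at h1
  exact absurd h1 (by simp; decide)

theorem eq_of_tree_eq_empty (h : 𝒢.tree = ∅) (s s' : V) : s = s' := by
  obtain ⟨l, ⟨hl, -, hlT⟩, -⟩ := 𝒢.isMaximalTree.2 s s'
  match l, hl, hlT with
  | [], hl, _ => exact hl
  | a :: l, _, hlT => exact absurd (hlT a (by simp)) (by simp [h])

theorem mem_edgeSubgroupO_of_mem_center (hmin : 𝒢.IsMinimal) (hs : ¬ 𝒢.IsSingleLoop)
    {z : 𝒢.FundGroup} (hz : z ∈ Subgroup.center 𝒢.FundGroup) (a : 𝒢.pos) :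
    z ∈ 𝒢.edgeSubgroupO a := by
  by_cases ha : (a : E) ∈ 𝒢.tree
  · exact mem_edgeSubgroupO_of_mem_tree hmin hz a ha
  rcases mem_edgeSubgroupO_or_of_notMem_tree hz a ha with h | ⟨h1, h2⟩
  · exact h
  rcases Set.eq_empty_or_nonempty 𝒢.tree with hT | ⟨b, hb⟩
  -- There is one vertex; a second positive edge would have its letter in a vertex group.
  · exfalso
    refine hs ⟨⟨𝒢.o a, fun s => eq_of_tree_eq_empty hT _ _⟩, a, ?_⟩
    by_contra! hcon
    obtain ⟨b, hba, hba'⟩ := hcon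
    obtain ⟨c, hca⟩ : ∃ c : 𝒢.pos, c ≠ a := by
      rcases 𝒢.pos_or_inv_pos b with h | h
      · exact ⟨⟨b, h⟩, fun h' => hba (congrArg Subtype.val h')⟩
      · refine ⟨⟨_, h⟩, fun h' => hba' ?_⟩
        rw [← congrArg Subtype.val h', 𝒢.inv_inv]
    obtain ⟨h, hh⟩ := h2 c hca
    exact t_notMem_vertexSubgroup (b := c) (by simp [hT]) (𝒢.o a) ⟨_, hh⟩
  · obtain ⟨c, hc⟩ : ∃ c : 𝒢.pos, (c : E) ∈ 𝒢.tree := by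
      rcases 𝒢.pos_or_inv_pos b with h | h
      · exact ⟨⟨b, h⟩, hb⟩
      · exact ⟨⟨_, h⟩, 𝒢.inv_mem_tree_iff.2 hb⟩
    obtain ⟨h, rfl⟩ := mem_edgeSubgroupO_of_mem_tree hmin hz c hc
    exact (h1 _ _).1

theorem mem_vertexSubgroup_of_forall {z : 𝒢.FundGroup}
    (hz : z ∈ Subgroup.center 𝒢.FundGroup) (h : ∀ a, z ∈ 𝒢.edgeSubgroupO a) (s : V) :
    z ∈ 𝒢.vertexSubgroup s := by
  by_cases hE : ∃ a, 𝒢.o a = s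
  · obtain ⟨a, rfl⟩ := hE
    rcases 𝒢.pos_or_inv_pos a with ha | ha
    · exact (mem_vertexSubgroup_of_mem_center hz (h ⟨a, ha⟩)).1
    · have := (mem_vertexSubgroup_of_mem_center hz (h ⟨_, ha⟩)).2
      rwa [𝒢.e_eq, 𝒢.inv_inv] at this
  -- With no edge at `s`, the connected graph is a single point and Γ = G_s.
  · have hV : ∀ s', s = s' := fun s' => by
      obtain ⟨l, hl⟩ := 𝒢.connected s s'
      match l, hl with
      | [], hl => exact hl
      | a :: l, hl => exact absurd ⟨a, hl.1⟩ hE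
    have : 𝒢.vertexSubgroup s = ⊤ := by
      refine 𝒢.eq_top_of_le (fun s' g => ?_) fun a _ _ => absurd ⟨a, (hV _).symm⟩ hE
      obtain rfl := hV s'
      exact ⟨g, rfl⟩
    rw [this]
    exact Subgroup.mem_top z

theorem center_eq_of_not_isSingleLoop [Finite E] (hmin : 𝒢.IsMinimal) (hs : ¬ 𝒢.IsSingleLoop) :
    Subgroup.center 𝒢.FundGroup =
      (⨅ s : V, 𝒢.vertexCenter s) ⊓ ⨅ a : 𝒢.pos, ⨅ _ : (a : E) ∉ 𝒢.tree, 𝒢.fix a := by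
  ext z
  simp only [Subgroup.mem_inf, Subgroup.mem_iInf]
  refine ⟨fun hz => ?_, fun hz => mem_center_of_mem hz.1 hz.2⟩
  have h := mem_edgeSubgroupO_of_mem_center hmin hs hz
  exact ⟨fun s => mem_vertexCenter_of_mem_center hz (mem_vertexSubgroup_of_forall hz h s),
    fun a _ => mem_fix_of_mem_center hz (h a)⟩

/-! ### The single loop. -/

section singleLoop

theorem IsSingleLoop.eq (hs : 𝒢.IsSingleLoop) (a b : 𝒢.pos) : a = b := by
  obtain ⟨-, c, hc⟩ := hs
  have hcc := 𝒢.inv_notMem_pos (a := c)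
  have := a.2
  have := b.2
  ext
  rcases hc a with ha | ha <;> rcases hc b with hb | hb <;> simp_all

theorem IsSingleLoop.notMem_tree (hs : 𝒢.IsSingleLoop) (a : E) : a ∉ 𝒢.tree := fun ha => by
  -- A loop in the tree would be a reduced closed path besides the empty one.
  have := (𝒢.isMaximalTree.2 (𝒢.o a) (𝒢.o a)).unique (y₁ := []) (y₂ := [a])
    ⟨rfl, List.isChain_nil, by simp⟩
    ⟨⟨rfl, hs.e_eq_o a⟩, List.isChain_singleton _, by simpa using ha⟩
  simp at this

theorem IsSingleLoop.vertex_eq (hs : 𝒢.IsSingleLoop) (s s' : V) : s = s' := by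
  obtain ⟨⟨s₀, h⟩, -⟩ := hs
  rw [h s, h s']

theorem IsSingleLoop.mem_center_of_mem (hs : 𝒢.IsSingleLoop) (a : 𝒢.pos) {z : 𝒢.FundGroup}
    (hz : z ∈ 𝒢.vertexCenter (𝒢.o a) ⊓ 𝒢.fix a) : z ∈ Subgroup.center 𝒢.FundGroup := by
  refine DecomposedGraphOfGroups.mem_center_of_mem (fun s => ?_) fun b _ => ?_
  · obtain rfl := hs.vertex_eq (𝒢.o a) s
    exact hz.1
  · obtain rfl := hs.eq a b
    exact hz.2

theorem mem_vertexCenter_inf_fix_of_mem_center [Finite E] (a : 𝒢.pos) {z : 𝒢.FundGroup}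
    (hz : z ∈ Subgroup.center 𝒢.FundGroup) (h : z ∈ 𝒢.edgeSubgroupO a) :
    z ∈ 𝒢.vertexCenter (𝒢.o a) ⊓ 𝒢.fix a :=
  ⟨mem_vertexCenter_of_mem_center hz (mem_vertexSubgroup_of_mem_center hz h).1,
    mem_fix_of_mem_center hz h⟩

theorem IsSingleLoop.center_eq_of_not_surjective [Finite E] (hs : 𝒢.IsSingleLoop) (a : 𝒢.pos)
    (h : ¬ Function.Surjective (𝒢.φo a) ∨ ¬ Function.Surjective (𝒢.φe a)) :
    Subgroup.center 𝒢.FundGroup = 𝒢.vertexCenter (𝒢.o a) ⊓ 𝒢.fix a := by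
  refine le_antisymm (fun z hz => ?_) fun z hz => hs.mem_center_of_mem a hz
  refine mem_vertexCenter_inf_fix_of_mem_center a hz ?_
  rcases mem_edgeSubgroupO_or_of_notMem_tree hz a (hs.notMem_tree a) with h' | ⟨h', -⟩
  · exact h'
  exfalso
  rcases h with h | h
  · refine h fun g => ?_
    obtain ⟨x, hx⟩ := (h' _ g).1
    exact ⟨x, 𝒢.vertexHom_injective _ hx⟩
  · refine h fun g => ?_
    obtain ⟨x, hx⟩ := (h' _ g).2
    exact ⟨x, 𝒢.vertexHom_injective _ hx⟩

variable (𝒢) in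
theorem vertexHom_castVertex {s s' : V} (h : s = s') (g : 𝒢.vertexGroup s) :
    𝒢.vertexHom s' (𝒢.castVertex h g) = 𝒢.vertexHom s g := by
  subst h; rfl

variable {a : 𝒢.pos} {hloop : 𝒢.e a = 𝒢.o a} {ho : Function.Surjective (𝒢.φo a)}
  {he : Function.Surjective (𝒢.φe a)}

theorem vertexHom_mul_t (x : 𝒢.vertexGroup (𝒢.o a)) :
    𝒢.vertexHom _ x * 𝒢.t a = 𝒢.t a * 𝒢.vertexHom _ (𝒢.loopAut a hloop ho he x) := by
  obtain ⟨h, rfl⟩ := ho x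
  have h1 : (MulEquiv.ofBijective (𝒢.φo a) ⟨𝒢.φo_injective a, ho⟩).symm (𝒢.φo a h) = h :=
    (MulEquiv.ofBijective (𝒢.φo a) ⟨𝒢.φo_injective a, ho⟩).symm_apply_apply h
  have h2 : 𝒢.loopAut a hloop ho he (𝒢.φo a h) = 𝒢.castVertex hloop (𝒢.φe a h) := by
    simp only [loopAut, MulEquiv.trans_apply, h1]
    rfl
  rw [h2, vertexHom_castVertex]
  exact 𝒢.edgeHomO_mul_t a h

theorem vertexHom_mul_t_zpow (x : 𝒢.vertexGroup (𝒢.o a)) (m : ℤ) :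
    𝒢.vertexHom _ x * 𝒢.t a ^ m =
      𝒢.t a ^ m * 𝒢.vertexHom _ ((𝒢.loopAut a hloop ho he ^ m) x) := by
  induction m with
  | zero => simp
  | succ m ih =>
    rw [zpow_add_one, ← mul_assoc, ih, mul_assoc,
      vertexHom_mul_t (hloop := hloop) (ho := ho) (he := he), ← mul_assoc, ← MulAut.mul_apply,
      ← zpow_one_add, add_comm]
  | pred m ih =>
    rw [zpow_sub_one, ← mul_assoc, ih, mul_assoc, mul_assoc]
    congr 1
    rw [mul_inv_eq_iff_eq_mul, mul_assoc, vertexHom_mul_t (hloop := hloop) (ho := ho) (he := he),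
      inv_mul_cancel_left, ← MulAut.mul_apply, ← zpow_one_add]
    congr 3
    ring_nf

theorem IsSingleLoop.exists_eq_mul (hs : 𝒢.IsSingleLoop) (ho : Function.Surjective (𝒢.φo a))
    (he : Function.Surjective (𝒢.φe a)) (z : 𝒢.FundGroup) :
    ∃ (m : ℤ) (c : 𝒢.vertexGroup (𝒢.o a)), z = 𝒢.t a ^ m * 𝒢.vertexHom _ c := by
  have key := vertexHom_mul_t_zpow (hloop := hs.e_eq_o a) (ho := ho) (he := he)
  let S : Subgroup 𝒢.FundGroup :=
    { carrier := {z | ∃ (m : ℤ) (c : 𝒢.vertexGroup (𝒢.o a)), z = 𝒢.t a ^ m * 𝒢.vertexHom _ c}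
      one_mem' := ⟨0, 1, by simp⟩
      mul_mem' := by
        rintro _ _ ⟨m, c, rfl⟩ ⟨n, d, rfl⟩
        refine ⟨m + n, (𝒢.loopAut a (hs.e_eq_o a) ho he ^ n) c * d, ?_⟩
        rw [map_mul, zpow_add, mul_assoc, ← mul_assoc (𝒢.vertexHom _ c), key]
        simp only [mul_assoc]
      inv_mem' := by
        rintro _ ⟨m, c, rfl⟩
        refine ⟨-m, (𝒢.loopAut a (hs.e_eq_o a) ho he ^ (-m)) c⁻¹, ?_⟩
        rw [← key, map_inv, zpow_neg, mul_inv_rev] }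
  have hS : S = ⊤ := by
    refine 𝒢.eq_top_of_le (fun s g => ?_) fun b hb _ => ?_
    · obtain rfl := hs.vertex_eq (𝒢.o a) s
      exact ⟨0, g, by simp⟩
    · obtain rfl : (a : E) = b := congrArg Subtype.val (hs.eq a ⟨b, hb⟩)
      exact ⟨1, 1, by simp⟩
  exact (hS ▸ Subgroup.mem_top z : z ∈ S)

/-- As Γ is generated by A and t_a, two tests suffice: commuting with t_a is the first condition,
and commuting with A, via `x t^m = t^m φ^m(x)`, is the second. -/
theorem IsSingleLoop.mem_center_iff [Finite E] (hs : 𝒢.IsSingleLoop)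
    (ho : Function.Surjective (𝒢.φo a)) (he : Function.Surjective (𝒢.φe a)) (m : ℤ)
    (c : 𝒢.vertexGroup (𝒢.o a)) :
    𝒢.t a ^ m * 𝒢.vertexHom _ c ∈ Subgroup.center 𝒢.FundGroup ↔
      𝒢.loopAut a (hs.e_eq_o a) ho he c = c ∧
      𝒢.loopAut a (hs.e_eq_o a) ho he ^ m = MulAut.conj c := by
  have key := vertexHom_mul_t_zpow (hloop := hs.e_eq_o a) (ho := ho) (he := he)
  have key1 := vertexHom_mul_t (hloop := hs.e_eq_o a) (ho := ho) (he := he)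
  set φ := 𝒢.loopAut a (hs.e_eq_o a) ho he
  have hinj := 𝒢.vertexHom_injective (𝒢.o a)
  have i1 : 𝒢.t a * (𝒢.t a ^ m * 𝒢.vertexHom _ c) = 𝒢.t a ^ m * 𝒢.vertexHom _ c * 𝒢.t a ↔
      φ c = c := by
    rw [mul_assoc, key1, ← mul_assoc, ← mul_assoc, (Commute.self_zpow (𝒢.t a) m).eq,
      mul_right_inj, hinj.eq_iff, eq_comm]
  have i2 : ∀ x, 𝒢.vertexHom _ x * (𝒢.t a ^ m * 𝒢.vertexHom _ c) =
      𝒢.t a ^ m * 𝒢.vertexHom _ c * 𝒢.vertexHom _ x ↔ (φ ^ m) x = MulAut.conj c x := by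
    intro x
    rw [← mul_assoc, key, mul_assoc, mul_assoc, mul_right_inj, ← map_mul, ← map_mul, hinj.eq_iff,
      MulAut.conj_apply, eq_mul_inv_iff_mul_eq]
  constructor
  · intro h
    have h' := Subgroup.mem_center_iff.1 h
    exact ⟨i1.1 (h' _), MulEquiv.ext fun x => (i2 x).1 (h' _)⟩
  · rintro ⟨h1, h2⟩
    have : Subgroup.centralizer {𝒢.t a ^ m * 𝒢.vertexHom _ c} = ⊤ := by
      refine 𝒢.eq_top_of_le (fun s g => ?_) fun b hb _ => ?_
      · obtain rfl := hs.vertex_eq (𝒢.o a) s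
        rw [Subgroup.mem_centralizer_singleton_iff]
        exact (i2 g).2 (by rw [h2])
      · obtain rfl : (a : E) = b := congrArg Subtype.val (hs.eq a ⟨b, hb⟩)
        rw [Subgroup.mem_centralizer_singleton_iff]
        exact i1.2 h1
    refine Subgroup.mem_center_iff.2 fun g => ?_
    have hg : g ∈ Subgroup.centralizer {𝒢.t a ^ m * 𝒢.vertexHom _ c} := this ▸ Subgroup.mem_top g
    exact Subgroup.mem_centralizer_singleton_iff.1 hg

theorem coe_zpow_eq_one_of_eq_conj {G : Type*} [Group G] {φ : MulAut G} {m : ℤ} {c : G}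
    (h : φ ^ m = MulAut.conj c) : (φ : OuterAut G) ^ m = 1 := by
  rw [← QuotientGroup.mk_zpow, QuotientGroup.eq_one_iff]
  exact ⟨c, h.symm⟩

theorem IsSingleLoop.center_eq_of_not_isOfFinOrder [Finite E] (hs : 𝒢.IsSingleLoop)
    (ho : Function.Surjective (𝒢.φo a)) (he : Function.Surjective (𝒢.φe a))
    (h : ¬ IsOfFinOrder
      (𝒢.loopAut a (hs.e_eq_o a) ho he : OuterAut (𝒢.vertexGroup (𝒢.o a)))) :
    Subgroup.center 𝒢.FundGroup = 𝒢.vertexCenter (𝒢.o a) ⊓ 𝒢.fix a := by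
  refine le_antisymm (fun z hz => ?_) fun z hz => hs.mem_center_of_mem a hz
  refine mem_vertexCenter_inf_fix_of_mem_center a hz ?_
  obtain ⟨m, c, rfl⟩ := hs.exists_eq_mul ho he z
  have h1 := coe_zpow_eq_one_of_eq_conj ((hs.mem_center_iff ho he m c).1 hz).2
  have hm : m = 0 := by
    by_contra hm
    exact h (isOfFinOrder_iff_zpow_eq_one.2 ⟨m, hm, h1⟩)
  obtain ⟨x, rfl⟩ := ho c
  exact ⟨x, by simp [hm, edgeHomO]⟩

theorem IsSingleLoop.center_eq_of_orderOf_eq [Finite E] (hs : 𝒢.IsSingleLoop)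
    (ho : Function.Surjective (𝒢.φo a)) (he : Function.Surjective (𝒢.φe a))
    {φ : MulAut (𝒢.vertexGroup (𝒢.o a))} (hφ : φ = 𝒢.loopAut a (hs.e_eq_o a) ho he) {n : ℕ}
    (hn : orderOf (φ : OuterAut (𝒢.vertexGroup (𝒢.o a))) = n) {a₀ : 𝒢.vertexGroup (𝒢.o a)}
    (ha₀ : ∀ x, (φ ^ n) x = a₀ * x * a₀⁻¹) :
    (Subgroup.center 𝒢.FundGroup : Set 𝒢.FundGroup) =
      ⋃ p : ℤ, {y | ∃ c, φ c = c ∧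
        (∃ ζ ∈ Subgroup.center (𝒢.vertexGroup (𝒢.o a)), c = a₀ ^ p * ζ) ∧
        y = 𝒢.t a ^ (p * n) * 𝒢.vertexHom (𝒢.o a) c} := by
  have hpow : ∀ p : ℤ, φ ^ (p * n) = MulAut.conj (a₀ ^ p) := fun p => by
    have : φ ^ n = MulAut.conj a₀ := MulEquiv.ext ha₀
    rw [mul_comm, zpow_mul, zpow_natCast, this, map_zpow]
  have hconj : ∀ (p : ℤ) (ζ : 𝒢.vertexGroup (𝒢.o a)),
      MulAut.conj (a₀ ^ p) = MulAut.conj (a₀ ^ p * ζ) ↔ ζ ∈ Subgroup.center _ := by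
    intro p ζ
    rw [map_mul, left_eq_mul, MulEquiv.ext_iff, Subgroup.mem_center_iff]
    refine forall_congr' fun x => ?_
    rw [MulAut.conj_apply, MulAut.one_apply, mul_inv_eq_iff_eq_mul, eq_comm]
  ext z
  simp only [SetLike.mem_coe, Set.mem_iUnion, Set.mem_ofPred_eq]
  constructor
  · intro hz
    obtain ⟨m, c, rfl⟩ := hs.exists_eq_mul ho he z
    rw [hs.mem_center_iff ho he, ← hφ] at hz
    -- φ^m is inner, so the order `n` divides `m`; then `c` and `a₀ ^ p` induce the same inner
    -- automorphism and differ by a central factor.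
    obtain ⟨p, rfl⟩ : ∃ p : ℤ, m = p * n := by
      have := orderOf_dvd_iff_zpow_eq_one.2 (coe_zpow_eq_one_of_eq_conj hz.2)
      rw [hn] at this
      obtain ⟨p, hp⟩ := this
      exact ⟨p, by rw [hp, mul_comm]⟩
    refine ⟨p, c, hz.1, ⟨(a₀ ^ p)⁻¹ * c, (hconj p _).1 ?_, by group⟩, rfl⟩
    rw [mul_inv_cancel_left, ← hpow, hz.2]
  · rintro ⟨p, c, hc, ⟨ζ, hζ, rfl⟩, rfl⟩
    rw [hs.mem_center_iff ho he, ← hφ, hpow]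
    exact ⟨hc, (hconj p ζ).2 hζ⟩

end singleLoop

end DecomposedGraphOfGroups

theorem mainTheorem4 {V : Type u} {E : Type v} [Finite V] [Finite E]
    (𝒢 : DecomposedGraphOfGroups.{u, v, w, z} V E) (hmin : 𝒢.IsMinimal) :
    (¬ 𝒢.IsSingleLoop →
      Subgroup.center 𝒢.FundGroup =
        (⨅ s : V, 𝒢.vertexCenter s) ⊓ ⨅ a : 𝒢.pos, ⨅ _ : (a : E) ∉ 𝒢.tree, 𝒢.fix a) ∧
    (∀ (hs : 𝒢.IsSingleLoop) (a : 𝒢.pos),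
      ((¬ Function.Surjective (𝒢.φo a) ∨ ¬ Function.Surjective (𝒢.φe a)) →
        Subgroup.center 𝒢.FundGroup = 𝒢.vertexCenter (𝒢.o a) ⊓ 𝒢.fix a) ∧
      (∀ (ho : Function.Surjective (𝒢.φo a)) (he : Function.Surjective (𝒢.φe a))
          (φ : MulAut (𝒢.vertexGroup (𝒢.o a))), φ = 𝒢.loopAut a (hs.e_eq_o a) ho he →
        (¬ IsOfFinOrder (φ : OuterAut (𝒢.vertexGroup (𝒢.o a))) →
          Subgroup.center 𝒢.FundGroup = 𝒢.vertexCenter (𝒢.o a) ⊓ 𝒢.fix a) ∧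
        (∀ n : ℕ, 0 < n → orderOf (φ : OuterAut (𝒢.vertexGroup (𝒢.o a))) = n →
          ∀ a₀ : 𝒢.vertexGroup (𝒢.o a), (∀ x, (φ ^ n) x = a₀ * x * a₀⁻¹) →
            (Subgroup.center 𝒢.FundGroup : Set 𝒢.FundGroup) =
              ⋃ p : ℤ, {y | ∃ c, φ c = c ∧
                (∃ ζ ∈ Subgroup.center (𝒢.vertexGroup (𝒢.o a)), c = a₀ ^ p * ζ) ∧
                y = 𝒢.t a ^ (p * n) * 𝒢.vertexHom (𝒢.o a) c}))) := by
  refine ⟨𝒢.center_eq_of_not_isSingleLoop hmin, fun hs a =>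
    ⟨hs.center_eq_of_not_surjective a, fun ho he φ hφ => ⟨fun h => ?_, fun n _ hn a₀ ha₀ =>
      hs.center_eq_of_orderOf_eq ho he hφ hn ha₀⟩⟩⟩
  subst hφ
  exact hs.center_eq_of_not_isOfFinOrder ho he h
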